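/- All graphs are finite, simple and undirected. For graphs $F,G$, let $\hom(F,G)$ be the number of graph homomorphisms $F\to G$ (maps $V(F)\to V(G)$ sending edges to edges), and let $d_F(v)$ be the degree of $v$ in $F$. Let $S(n,k)$ be the Stirling number of the second kind. For a bipartite graph $G$ with partite sets $\mathcal L,\mathcal R$, let $N_{k,\ell}(G)$ be the number of pairs $(A,B)$ with $A\subseteq\mathcal L$, $|A|=k$, $B\subseteq\mathcal R$, $|B|=\ell$, such that every vertex of $A$ is adjacent to every vertex of $B$. Let $F$ be a bipartite graph with $s\ge 0$ isolated vertices. 1. For every bipartite graph $G$ with at least one vertex, and every choice of partite sets $\mathcal L,\mathcal R$ of $G$, $$\frac{\hom(F,G)}{|V(G)|^s}\le\prod_{\{u,v\}\in E(F)}\left(\sum_{k=1}^{d_F(u)}\sum_{\ell=1}^{d_F(v)}k!\,\ell!\,S(d_F(u),k)\,S(d_F(v),\ell)\,\bigl[N_{k,\ell}(G)+N_{\ell,k}(G)\bigr]\right)^{\frac1{d_F(u)\,d_F(v)}},$$ with equality if $F$ is a disjoint union of isolated vertices and complete bipartite graphs. 2. For every bipartite graph $G$ that contains no $4$-cycle,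 $$\hom(F,G)\le|V(G)|^s\prod_{\{u,v\}\in E(F)}\left(\sum_{w\in V(G)}\bigl\{d_G(w)^{d_F(u)}+d_G(w)^{d_F(v)}\bigr\}-2\,|E(G)|\right)^{\frac1{d_F(u)\,d_F(v)}},$$ with equality if $F$ is a disjoint union of isolated vertices and star graphs $K_{1,m}$, $m\ge1$. -/

import Mathlib

namespace BipartiteHom

/-- The number of graph homomorphisms from `F` to `G`. -/
noncomputable def homCount {V W : Type*} (F : SimpleGraph V) (G : SimpleGraph W) : ℕ :=
  Nat.card (F →g G)

/-- The number of isolated vertices of `F`. -/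
noncomputable def isolatedCount {V : Type*} (F : SimpleGraph V) : ℕ :=
  {v : V | F.IsIsolated v}.ncard

/-- The number of (labelled) bipartite cliques of `G` whose parts in `L` and `R` have sizes
`k` and `l`: pairs `(A, B)` with `A ⊆ L`, `|A| = k`, `B ⊆ R`, `|B| = l` such that every vertex of
`A` is adjacent to every vertex of `B`. -/
def bicliqueCount {W : Type*} (G : SimpleGraph W) [DecidableRel G.Adj]
    (L R : Finset W) (k l : ℕ) : ℕ :=
  ((L.powersetCard k ×ˢ R.powersetCard l).filter
    (fun P => ∀ a ∈ P.1, ∀ b ∈ P.2, G.Adj a b)).card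

/-- `∑_{k=1}^p ∑_{l=1}^q k! l! S(p,k) S(q,l) (N_{k,l}(G) + N_{l,k}(G))`, where `S` denotes the
Stirling numbers of the second kind. -/
def bicliqueSum {W : Type*} (G : SimpleGraph W) [DecidableRel G.Adj]
    (L R : Finset W) (p q : ℕ) : ℕ :=
  ∑ k ∈ Finset.Icc 1 p, ∑ l ∈ Finset.Icc 1 q,
    k.factorial * l.factorial * p.stirlingSecond k * q.stirlingSecond l *
      (bicliqueCount G L R k l + bicliqueCount G L R l k)

theorem bicliqueSum_comm {W : Type*} (G : SimpleGraph W) [DecidableRel G.Adj]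
    (L R : Finset W) (p q : ℕ) : bicliqueSum G L R p q = bicliqueSum G L R q p := by
  unfold bicliqueSum
  rw [Finset.sum_comm]
  refine Finset.sum_congr rfl fun k _ => Finset.sum_congr rfl fun l _ => ?_
  ring

/-- `∑_{w ∈ V(G)} (d(w)^p + d(w)^q) - 2 |E(G)|`. -/
def degreeSum {W : Type*} [Fintype W] [DecidableEq W] (G : SimpleGraph W) [DecidableRel G.Adj]
    (p q : ℕ) : ℝ :=
  ∑ w : W, ((G.degree w : ℝ) ^ p + (G.degree w : ℝ) ^ q) - 2 * (G.edgeFinset.card : ℝ)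

theorem degreeSum_comm {W : Type*} [Fintype W] [DecidableEq W] (G : SimpleGraph W)
    [DecidableRel G.Adj] (p q : ℕ) : degreeSum G p q = degreeSum G q p := by
  unfold degreeSum
  simp only [add_comm]

/-- For a symmetric function `f` of two natural numbers, the product
`∏_{uv ∈ E(F)} f(d(u), d(v)) ^ (1 / (d(u) d(v)))` over the edges of `F`. -/
noncomputable def edgeProd {V : Type*} [Fintype V] [DecidableEq V] (F : SimpleGraph V)
    [DecidableRel F.Adj] (f : ℕ → ℕ → ℝ) (hf : ∀ p q, f p q = f q p) : ℝ :=
  ∏ e ∈ F.edgeFinset,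
    Sym2.lift ⟨fun u v => f (F.degree u) (F.degree v) ^
        (1 / ((F.degree u : ℝ) * (F.degree v : ℝ))),
      fun u v => by
        beta_reduce
        rw [hf, mul_comm (F.degree u : ℝ)]⟩ e

/-- `F` is a disjoint union of isolated vertices and complete bipartite graphs `K_{p,q}`,
`p, q ≥ 1`: every connected component of `F` is one of these. -/
def IsUnionOfBicliques {V : Type*} (F : SimpleGraph V) : Prop :=
  ∀ c : F.ConnectedComponent,
    Nonempty (c.toSimpleGraph ≃g (⊥ : SimpleGraph (Fin 1))) ∨
    ∃ p q : ℕ, 1 ≤ p ∧ 1 ≤ q ∧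
      Nonempty (c.toSimpleGraph ≃g completeBipartiteGraph (Fin p) (Fin q))

/-- `F` is a disjoint union of isolated vertices and stars `K_{1,m}`, `m ≥ 1`: every connected
component of `F` is one of these. -/
def IsUnionOfStars {V : Type*} (F : SimpleGraph V) : Prop :=
  ∀ c : F.ConnectedComponent,
    Nonempty (c.toSimpleGraph ≃g (⊥ : SimpleGraph (Fin 1))) ∨
    ∃ m : ℕ, 1 ≤ m ∧
      Nonempty (c.toSimpleGraph ≃g completeBipartiteGraph (Fin 1) (Fin m))

end BipartiteHom

namespace BipartiteHom

open Finset
open scoped NNReal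

/-! Both parts follow from one bound:
$\hom(F,G)\le|V(G)|^s\prod_{uv}\hom(K_{d(u),d(v)},G)^{1/(d(u)d(v))}$ (`homCount_le`).

It is proved in a weighted form, with a separate weight on each edge of $F$, so that induction is
possible (`sum_prod_starWeight_le`). Remove a vertex of maximum degree $D$ from one side and fix its
image $z$. Its edge weights are absorbed into the remaining edges at its neighbours, which leaves a
smaller weighted instance. Hölder over the $D$ neighbours reduces the sum over $z$ to an inequality
at a single neighbour (`sum_starBound_pow_le`). A second Hölder, over the other neighbours of that
vertex, reduces it to the mixed-norm inequality `sum_rpow_sum_pow_mul_le`. There a sum $A$ satisfies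
$A\le BA^{1-a/D}$, where $a\le D$ is the degree of another neighbour; removing vertices in
decreasing order of degree ensures $a\le D$.

It remains to evaluate $\hom(K_{p,q},G)$. Grouping pairs of tuples by their images gives the
Stirling sum. Without 4-cycles one of the two tuples must be constant, and inclusion–exclusion gives
the degree sum. Equality holds because $\hom$ is multiplicative over components and $K_{p,q}$ has
$pq$ edges, each with exponent $1/(pq)$. -/

/-! ### Hölder's inequality for finite sums -/

theorem sum_prod_le_prod_sum_rpow {ι α : Type*} [Fintype α] (s : Finset ι) (f : ι → α → ℝ≥0)
    (p : ι → ℝ) (hp : ∑ i ∈ s, p i = 1) (hp0 : ∀ i ∈ s, 0 ≤ p i) :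
    ∑ a, ∏ i ∈ s, f i a ^ p i ≤ ∏ i ∈ s, (∑ a, f i a) ^ p i := by
  let _ : MeasurableSpace α := ⊤
  have h := ENNReal.lintegral_prod_norm_pow_le (μ := MeasureTheory.Measure.count) s
    (f := fun i a => (f i a : ENNReal)) (fun i _ => (measurable_of_finite _).aemeasurable) hp hp0
  simp only [MeasureTheory.lintegral_count, tsum_fintype] at h
  rw [← ENNReal.coe_le_coe]
  push_cast
  convert h using 1
  · refine sum_congr rfl fun a _ => prod_congr rfl fun i hi => ?_
    rw [ENNReal.coe_rpow_of_nonneg _ (hp0 i hi)]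
  · refine prod_congr rfl fun i hi => ?_
    rw [ENNReal.coe_rpow_of_nonneg _ (hp0 i hi)]
    push_cast
    rfl

/-- Hölder's inequality for a product of `#s` functions, with equal exponents `#s`. -/
theorem sum_prod_le_prod_sum_pow_card {ι α : Type*} [Fintype α] (s : Finset ι) (hs : s.Nonempty)
    (f : ι → α → ℝ≥0) :
    ∑ a, ∏ i ∈ s, f i a ≤ ∏ i ∈ s, (∑ a, f i a ^ s.card) ^ (1 / (s.card : ℝ)) := by
  have hc : (s.card : ℝ) ≠ 0 := by exact_mod_cast hs.card_ne_zero
  have h := sum_prod_le_prod_sum_rpow s (fun i a => f i a ^ s.card) (fun _ => 1 / (s.card : ℝ))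
    (by simp [hc]) (fun _ _ => by positivity)
  refine le_trans (le_of_eq ?_) h
  refine sum_congr rfl fun a _ => prod_congr rfl fun i _ => ?_
  rw [← NNReal.rpow_natCast, ← NNReal.rpow_mul, mul_one_div_cancel hc, NNReal.rpow_one]

theorem inner_le_rpow {α : Type*} [Fintype α] (f g : α → ℝ≥0) (t : ℝ) (ht0 : 0 ≤ t)
    (ht1 : t ≤ 1) :
    ∑ a, f a ^ t * g a ^ (1 - t) ≤ (∑ a, f a) ^ t * (∑ a, g a) ^ (1 - t) := by
  have h := sum_prod_le_prod_sum_rpow (α := α) (univ : Finset (Fin 2)) ![f, g] ![t, 1 - t]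
    (by simp) (by simp [Fin.forall_fin_two, ht0, ht1])
  simpa using h

/-! ### Weighted biclique counts and the mixed-norm inequality -/

/-- The number of weighted homomorphisms of `K_{p,q}`, one side of which has size `p` and takes
values in `Y`, the other having size `q` and taking values in `X`. -/
noncomputable def bicliqueWeight {X Y : Type*} [Fintype X] [Fintype Y] (f : X → Y → ℝ≥0)
    (p q : ℕ) : ℝ≥0 :=
  ∑ y : Fin p → Y, (∑ x, ∏ j, f x (y j)) ^ q

theorem bicliqueWeight_swap {X Y : Type*} [Fintype X] [Fintype Y] (f : X → Y → ℝ≥0) (p q : ℕ) :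
    bicliqueWeight f p q = bicliqueWeight (fun y x => f x y) q p := by
  unfold bicliqueWeight
  simp only [Fintype.sum_pow]
  rw [sum_comm]
  refine sum_congr rfl fun x _ => sum_congr rfl fun y _ => ?_
  rw [prod_comm]

theorem le_of_self_improving {A B : ℝ≥0} {t : ℝ} (ht0 : 0 < t) (h : A ≤ B * A ^ (1 - t)) :
    A ≤ B ^ (1 / t) := by
  rcases eq_or_ne A 0 with rfl | hA
  · exact zero_le
  have h1 : A ^ t ≤ B := by
    have h2 : A ^ t * A ^ (1 - t) ≤ B * A ^ (1 - t) := by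
      rwa [← NNReal.rpow_add hA, add_sub_cancel, NNReal.rpow_one]
    exact le_of_mul_le_mul_right h2 (NNReal.rpow_pos (pos_iff_ne_zero.2 hA))
  calc A = (A ^ t) ^ (1 / t) := by
        rw [← NNReal.rpow_mul, mul_one_div_cancel ht0.ne', NNReal.rpow_one]
    _ ≤ _ := NNReal.rpow_le_rpow h1 (by positivity)

/-- Hölder's inequality with exponents `(b + 1) / b` and `b + 1`. -/
theorem sum_pow_mul_le {α : Type*} [Fintype α] (h k : α → ℝ≥0) (b : ℕ) :
    ∑ a, h a ^ b * k a ≤ (∑ a, h a ^ (b + 1)) ^ ((b : ℝ) / (b + 1)) *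
      (∑ a, k a ^ (b + 1)) ^ (1 / ((b : ℝ) + 1)) := by
  have hb : (b : ℝ) + 1 ≠ 0 := by positivity
  have e : 1 - (b : ℝ) / (b + 1) = 1 / (b + 1) := by field_simp; ring
  have := inner_le_rpow (fun a => h a ^ (b + 1)) (fun a => k a ^ (b + 1)) ((b : ℝ) / (b + 1))
    (by positivity) (by rw [div_le_one (by positivity)]; linarith)
  rw [e] at this
  refine le_trans (le_of_eq ?_) this
  refine sum_congr rfl fun a _ => ?_
  have e1 : ((b + 1 : ℕ) : ℝ) * ((b : ℝ) / (b + 1)) = (b : ℕ) := by push_cast; field_simp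
  have e2 : ((b + 1 : ℕ) : ℝ) * (1 / ((b : ℝ) + 1)) = 1 := by push_cast; field_simp
  rw [← NNReal.rpow_natCast (h a) (b + 1), ← NNReal.rpow_natCast (k a) (b + 1),
    ← NNReal.rpow_mul, ← NNReal.rpow_mul, e1, e2, NNReal.rpow_one, NNReal.rpow_natCast]

/-- The `(b + 1)`-st moment of a weighted sum of tensor powers. -/
theorem sum_weighted_tensor_pow_le {Z Y : Type*} [Fintype Z] [Fintype Y] (g : Z → Y → ℝ≥0)
    (w : Z → ℝ≥0) (a D b : ℕ) (ha : 0 < a) (haD : a ≤ D) :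
    ∑ y : Fin a → Y, (∑ z, w z ^ (1 - (a : ℝ) / D) * ∏ j, g z (y j)) ^ b ≤
      bicliqueWeight g D b ^ ((a : ℝ) / D) * ((∑ z, w z) ^ b) ^ (1 - (a : ℝ) / D) := by
  have hD : (0 : ℝ) < D := by exact_mod_cast ha.trans_le haD
  have h1 : (a : ℝ) / D ≤ 1 := by rw [div_le_one hD]; exact_mod_cast haD
  -- Once the power is expanded over `z : Fin b → Z`, the coordinates of `y` separate and give an
  -- `a`-th power. Writing it as the `a / D` power of a `D`-th power prepares Hölder with weights `a
  -- / D` and `1 - a / D`.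
  have key : ∑ y : Fin a → Y, (∑ z, w z ^ (1 - (a : ℝ) / D) * ∏ j, g z (y j)) ^ b =
      ∑ z : Fin b → Z, ((∑ y, ∏ i, g (z i) y) ^ D) ^ ((a : ℝ) / D) *
        (∏ i, w (z i)) ^ (1 - (a : ℝ) / D) := by
    simp only [Fintype.sum_pow]
    rw [sum_comm]
    refine sum_congr rfl fun z _ => ?_
    rw [← Fintype.sum_pow (fun y => ∏ i, g (z i) y), ← NNReal.rpow_natCast _ D, ← NNReal.rpow_mul,
      mul_div_cancel₀ _ hD.ne', NNReal.rpow_natCast, Fintype.sum_pow, sum_mul]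
    refine sum_congr rfl fun y _ => ?_
    rw [prod_mul_distrib, NNReal.finsetProd_rpow, mul_comm, prod_comm]
  rw [key]
  refine (inner_le_rpow _ _ _ (by positivity) h1).trans (le_of_eq ?_)
  rw [bicliqueWeight_swap, bicliqueWeight, Fintype.sum_pow]

/-- The mixed-norm inequality behind the induction step. -/
theorem sum_rpow_sum_pow_mul_le {Z Y : Type*} [Fintype Z] [Fintype Y] (g : Z → Y → ℝ≥0)
    (a D b : ℕ) (ha : 0 < a) (haD : a ≤ D) (h : (Fin a → Y) → ℝ≥0) :
    ∑ z, (∑ y : Fin a → Y, h y ^ b * ∏ j, g z (y j)) ^ ((D : ℝ) / a) ≤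
      (∑ y, h y ^ (b + 1)) ^ (((D : ℝ) * b) / (a * (b + 1))) *
        bicliqueWeight g D (b + 1) ^ (1 / ((b : ℝ) + 1)) := by
  have hD : (0 : ℝ) < D := by exact_mod_cast ha.trans_le haD
  have ha' : (0 : ℝ) < a := by exact_mod_cast ha
  set M : Z → ℝ≥0 := fun z => ∑ y : Fin a → Y, h y ^ b * ∏ j, g z (y j) with hM
  set w : Z → ℝ≥0 := fun z => M z ^ ((D : ℝ) / a) with hw
  set t : ℝ := (a : ℝ) / D with ht
  have ht0 : 0 < t := by positivity
  have ht1 : t ≤ 1 := by rw [ht, div_le_one hD]; exact_mod_cast haD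
  have hwM : ∀ z, w z = w z ^ (1 - t) * M z := by
    intro z
    have h1 : M z = w z ^ t := by
      rw [hw, ← NNReal.rpow_mul, ht, div_mul_div_cancel₀ ha'.ne', div_self hD.ne',
        NNReal.rpow_one]
    rw [h1, ← NNReal.rpow_add_of_nonneg _ (by linarith) ht0.le, sub_add_cancel, NNReal.rpow_one]
  have hb1 : (b : ℝ) + 1 ≠ 0 := by positivity
  -- Only one factor `M z` is split off from `w z`, so the sum is linear in the kernel `g` and can
  -- be exchanged with the sum over `y`; the leftover `w z ^ (1 - t)` makes the estimate
  -- self-improving.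
  have step : ∑ z, w z ≤ ((∑ y, h y ^ (b + 1)) ^ ((b : ℝ) / (b + 1)) *
      bicliqueWeight g D (b + 1) ^ (t / ((b : ℝ) + 1))) * (∑ z, w z) ^ (1 - t) := by
    calc ∑ z, w z = ∑ y, h y ^ b * ∑ z, w z ^ (1 - t) * ∏ j, g z (y j) := by
          rw [sum_congr rfl fun z _ => hwM z]
          simp only [hM, mul_sum]
          rw [sum_comm]
          exact sum_congr rfl fun y _ => sum_congr rfl fun z _ => by ring
      _ ≤ _ := sum_pow_mul_le _ _ _
      _ ≤ (∑ y, h y ^ (b + 1)) ^ ((b : ℝ) / (b + 1)) *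
          (bicliqueWeight g D (b + 1) ^ t * ((∑ z, w z) ^ (b + 1)) ^ (1 - t)) ^
            (1 / ((b : ℝ) + 1)) := by
          gcongr
          exact sum_weighted_tensor_pow_le g w a D (b + 1) ha haD
      _ = _ := by
          rw [NNReal.mul_rpow, ← NNReal.rpow_mul, ← NNReal.rpow_natCast, ← NNReal.rpow_mul,
            ← NNReal.rpow_mul, mul_assoc, mul_one_div]
          congr 3
          push_cast
          field_simp
  refine (le_of_self_improving ht0 step).trans (le_of_eq ?_)
  rw [NNReal.mul_rpow, ← NNReal.rpow_mul, ← NNReal.rpow_mul, ht]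
  congr 2 <;> field_simp

/-! ### Induction on the vertices of one side -/

/-- The factor that a vertex with neighbourhood `P` contributes to a weighted homomorphism count
once the images `x i` of its neighbours are fixed. A vertex without neighbours contributes `c`. -/
noncomputable def starWeight {X Y : Type*} [Fintype Y] {n : ℕ} (P : Fin n → Prop)
    [DecidablePred P] (c : ℝ≥0) (f : Fin n → X → Y → ℝ≥0) (x : Fin n → X) : ℝ≥0 :=
  if #{i | P i} = 0 then c else ∑ y, ∏ i with P i, f i (x i) y

/-- The bound attached to a vertex with neighbourhood `P`, whose neighbours have degrees `d`. -/
noncomputable def starBound {X Y : Type*} [Fintype X] [Fintype Y] {n : ℕ} (P : Fin n → Prop)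
    [DecidablePred P] (d : Fin n → ℕ) (c : ℝ≥0) (f : Fin n → X → Y → ℝ≥0) : ℝ≥0 :=
  if #{i | P i} = 0 then c else
    ∏ i with P i, bicliqueWeight (f i) (d i) #{i | P i} ^ (1 / ((d i : ℝ) * #{i | P i}))

section Step

variable {X Y : Type*} [Fintype Y] {n : ℕ} (P : Fin (n + 1) → Prop) [DecidablePred P]

theorem prod_filter_univ_succ {M : Type*} [CommMonoid M] (g : Fin (n + 1) → M) :
    ∏ i with P i, g i = (if P 0 then g 0 else 1) * ∏ i with P (Fin.succ i), g i.succ := by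
  rw [prod_filter, Fin.prod_univ_succ, prod_filter]

theorem starWeight_cons_of_not (h0 : ¬ P 0) (c : ℝ≥0) (f : Fin (n + 1) → X → Y → ℝ≥0) (z : X)
    (x : Fin n → X) :
    starWeight P c f (Fin.cons z x) =
      starWeight (fun i => P i.succ) c (fun i => f i.succ) x := by
  unfold starWeight
  simp only [Fin.card_filter_univ_succ, prod_filter_univ_succ, if_neg h0, Fin.cons_succ, one_mul]

/-- The factor `f 0 z y` is spread evenly, as roots, over the remaining neighbours, so a weighted
instance with one vertex fewer is left. If no neighbour remains, the factor survives as the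
constant; this is why `starWeight` carries `c`. -/
theorem starWeight_cons (h0 : P 0) (c : ℝ≥0) (f : Fin (n + 1) → X → Y → ℝ≥0) (z : X)
    (x : Fin n → X) :
    starWeight P c f (Fin.cons z x) =
      starWeight (fun i => P i.succ) (∑ y, f 0 z y)
        (fun i x y => f i.succ x y * f 0 z y ^ (1 / (#{i | P (Fin.succ i)} : ℝ))) x := by
  unfold starWeight
  simp only [Fin.card_filter_univ_succ, prod_filter_univ_succ, if_pos h0, Fin.cons_succ,
    Fin.cons_zero, Nat.succ_ne_zero, if_false]
  split_ifs with h
  · rw [card_eq_zero] at h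
    simp [h]
  · refine sum_congr rfl fun y _ => ?_
    have h' : (#{i | P (Fin.succ i)} : ℝ) ≠ 0 := by exact_mod_cast h
    rw [prod_mul_distrib, prod_const, ← NNReal.rpow_natCast, ← NNReal.rpow_mul,
      one_div_mul_cancel h', NNReal.rpow_one, mul_comm]

variable [Fintype X]

theorem starBound_succ_of_not (h0 : ¬ P 0) (d : Fin (n + 1) → ℕ) (c : ℝ≥0)
    (f : Fin (n + 1) → X → Y → ℝ≥0) :
    starBound (fun i => P i.succ) (fun i => d i.succ) c (fun i => f i.succ) =
      starBound P d c f := by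
  unfold starBound
  simp only [Fin.card_filter_univ_succ, prod_filter_univ_succ, if_neg h0, one_mul]

theorem bicliqueWeight_mul_rpow (f : X → Y → ℝ≥0) (g : Y → ℝ≥0) (a b : ℕ) (hb : b ≠ 0) :
    bicliqueWeight (fun x y => f x y * g y ^ (1 / (b : ℝ))) a b =
      ∑ y : Fin a → Y, (∑ x, ∏ j, f x (y j)) ^ b * ∏ j, g (y j) := by
  have hb' : (b : ℝ) ≠ 0 := by exact_mod_cast hb
  unfold bicliqueWeight
  refine sum_congr rfl fun y _ => ?_
  simp only [prod_mul_distrib]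
  rw [← sum_mul, mul_pow]
  congr 1
  rw [NNReal.finsetProd_rpow, ← NNReal.rpow_natCast, ← NNReal.rpow_mul, one_div_mul_cancel hb',
    NNReal.rpow_one]

/-- The induction step seen from one neighbour of the removed vertex: the `d 0`-norm over `z` of the
bound for the smaller instance is at most the bound for the original one. -/
theorem sum_starBound_pow_le (h0 : P 0) (d : Fin (n + 1) → ℕ) (hd : ∀ i, d i ≤ d 0)
    (hd0 : ∀ i, P i → 0 < d i) (c : ℝ≥0) (f : Fin (n + 1) → X → Y → ℝ≥0) :
    (∑ z, starBound (fun i => P i.succ) (fun i => d i.succ) (∑ y, f 0 z y)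
        (fun i x y => f i.succ x y * f 0 z y ^ (1 / (#{i | P (Fin.succ i)} : ℝ))) ^ d 0) ^
      (1 / (d 0 : ℝ)) ≤ starBound P d c f := by
  unfold starBound
  simp only [Fin.card_filter_univ_succ, prod_filter_univ_succ, if_pos h0, Nat.succ_ne_zero,
    if_false]
  have hD : (0 : ℝ) < d 0 := by exact_mod_cast hd0 0 h0
  split_ifs with h
  -- No other neighbour: both sides are the `d 0`-norm of `z ↦ ∑ y, f 0 z y`.
  · rw [h, bicliqueWeight_swap]
    rw [card_eq_zero] at h
    refine le_of_eq ?_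
    rw [h]
    simp only [bicliqueWeight, zero_add, Nat.cast_one, mul_one, prod_empty]
    congr 1
    exact Fintype.sum_equiv (Equiv.funUnique (Fin 1) X).symm _ _ (by simp)
  · set s : Finset (Fin n) := {i | P (Fin.succ i)} with hs
    set b := #s with hb
    have hb' : (0 : ℝ) < b := by exact_mod_cast Nat.pos_of_ne_zero h
    have hsne : s.Nonempty := card_ne_zero.1 h
    have hb1 : (0 : ℝ) < (b : ℝ) + 1 := by positivity
    have holder := sum_prod_le_prod_sum_pow_card s hsne (fun i z =>
      (bicliqueWeight (fun x y => f i.succ x y * f 0 z y ^ (1 / (b : ℝ))) (d i.succ) b ^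
        (1 / ((d i.succ : ℝ) * b))) ^ d 0)
    rw [← hb] at holder
    -- The mixed-norm inequality with `h y = ∑ x, ∏ j, f i.succ x (y j)`. Each of the `b` neighbours
    -- yields the count for `f 0` to the power `1 / (b * (b + 1))`; together they give `1 / (b +
    -- 1)`.
    have term : ∀ i ∈ s, (∑ z, ((bicliqueWeight (fun x y => f i.succ x y *
        f 0 z y ^ (1 / (b : ℝ))) (d i.succ) b ^ (1 / ((d i.succ : ℝ) * b))) ^ d 0) ^ b) ^
          (1 / (b : ℝ)) ≤ (bicliqueWeight (f i.succ) (d i.succ) (b + 1) ^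
            (1 / ((d i.succ : ℝ) * (b + 1)))) ^ (d 0 : ℝ) *
            bicliqueWeight (f 0) (d 0) (b + 1) ^ (1 / ((b : ℝ) * (b + 1))) := by
      intro i hi
      have hi' : 0 < d i.succ := hd0 _ (by simpa [hs] using hi)
      have hi'' : (0 : ℝ) < d i.succ := by exact_mod_cast hi'
      have e : ∀ z, ((bicliqueWeight (fun x y => f i.succ x y *
          f 0 z y ^ (1 / (b : ℝ))) (d i.succ) b ^ (1 / ((d i.succ : ℝ) * b))) ^ d 0) ^ b =
          (∑ y : Fin (d i.succ) → Y, (∑ x, ∏ j, f i.succ x (y j)) ^ b * ∏ j, f 0 z (y j)) ^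
            ((d 0 : ℝ) / d i.succ) := by
        intro z
        rw [bicliqueWeight_mul_rpow _ _ _ _ h, ← pow_mul, ← NNReal.rpow_natCast,
          ← NNReal.rpow_mul]
        congr 1
        push_cast
        field_simp
      rw [sum_congr rfl fun z _ => e z]
      refine (NNReal.rpow_le_rpow (sum_rpow_sum_pow_mul_le (f 0) (d i.succ) (d 0) b hi' (hd _)
        (fun y => ∑ x, ∏ j, f i.succ x (y j))) (by positivity)).trans (le_of_eq ?_)
      rw [NNReal.mul_rpow, ← NNReal.rpow_mul, ← NNReal.rpow_mul, ← NNReal.rpow_mul]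
      unfold bicliqueWeight
      congr 2 <;> field_simp
    calc _ = (∑ z, ∏ i ∈ s, (bicliqueWeight (fun x y => f i.succ x y *
          f 0 z y ^ (1 / (b : ℝ))) (d i.succ) b ^ (1 / ((d i.succ : ℝ) * b))) ^ d 0) ^
            (1 / (d 0 : ℝ)) := by simp only [prod_pow]
      _ ≤ (∏ i ∈ s, ((bicliqueWeight (f i.succ) (d i.succ) (b + 1) ^
            (1 / ((d i.succ : ℝ) * (b + 1)))) ^ (d 0 : ℝ) *
            bicliqueWeight (f 0) (d 0) (b + 1) ^ (1 / ((b : ℝ) * (b + 1))))) ^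
              (1 / (d 0 : ℝ)) :=
          NNReal.rpow_le_rpow (holder.trans (prod_le_prod' term)) (by positivity)
      _ = _ := by
          rw [prod_mul_distrib, prod_const, ← hb, NNReal.mul_rpow, mul_comm,
            NNReal.finsetProd_rpow, ← NNReal.rpow_mul, mul_one_div_cancel hD.ne',
            NNReal.rpow_one, ← NNReal.rpow_natCast, ← NNReal.rpow_mul, ← NNReal.rpow_mul]
          push_cast
          congr 2
          field_simp

end Step

/-- The weighted form of the inequality: vertices `v : β` on one side, vertices `i : Fin n` on the
other side, listed by decreasing degree `d i`. -/
theorem sum_prod_starWeight_le {β X Y : Type*} [Fintype β] [Fintype X] [Fintype Y] (n : ℕ)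
    (N : β → Fin n → Prop) [∀ v, DecidablePred (N v)] (d : Fin n → ℕ) (hanti : Antitone d)
    (hd : ∀ i, #{v | N v i} = d i) (c : β → ℝ≥0) (f : β → Fin n → X → Y → ℝ≥0) :
    ∑ x : Fin n → X, ∏ v, starWeight (N v) (c v) (f v) x ≤
      (Fintype.card X : ℝ≥0) ^ #{i | d i = 0} * ∏ v, starBound (N v) d (c v) (f v) := by
  induction n generalizing c with
  | zero => simp [starWeight, starBound]
  | succ n ih =>
    have hd0 : ∀ v i, N v i → 0 < d i := fun v i hv => by
      rw [← hd i]; exact card_pos.2 ⟨v, by simpa using hv⟩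
    have hle : ∀ i, d i ≤ d 0 := fun i => hanti (Fin.zero_le i)
    set c' : X → β → ℝ≥0 := fun z v => if N v 0 then ∑ y, f v 0 z y else c v with hc'
    set f' : X → β → Fin n → X → Y → ℝ≥0 := fun z v => if N v 0 then
      fun i x y => f v i.succ x y * f v 0 z y ^ (1 / (#{i | N v (Fin.succ i)} : ℝ))
      else fun i => f v i.succ with hf'
    have hcons : ∀ z (x : Fin n → X) v, starWeight (N v) (c v) (f v) (Fin.cons z x) =
        starWeight (fun i => N v i.succ) (c' z v) (f' z v) x := by
      intro z x v
      by_cases h : N v 0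
      · simp only [hc', hf', if_pos h]; exact starWeight_cons _ h _ _ _ _
      · simp only [hc', hf', if_neg h]; exact starWeight_cons_of_not _ h _ _ _ _
    have key : ∑ x : Fin (n + 1) → X, ∏ v, starWeight (N v) (c v) (f v) x ≤
        (Fintype.card X : ℝ≥0) ^ #{i | d (Fin.succ i) = 0} *
          ∑ z, ∏ v, starBound (fun i => N v i.succ) (fun i => d i.succ) (c' z v) (f' z v) := by
      rw [← (Fin.consEquiv fun _ => X).sum_comp, Fintype.sum_prod_type, mul_sum]
      refine sum_le_sum fun z _ => ?_
      simp only [Fin.consEquiv, Equiv.coe_fn_mk, hcons]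
      exact ih (fun v i => N v i.succ) (fun i => d i.succ)
        (fun i j hij => hanti (Fin.succ_le_succ_iff.2 hij)) (fun i => hd _) _ _
    refine key.trans ?_
    rw [Fin.card_filter_univ_succ]
    have hnot : ∀ z v, ¬ N v 0 → starBound (fun i => N v i.succ) (fun i => d i.succ) (c' z v)
        (f' z v) = starBound (N v) d (c v) (f v) := by
      intro z v h
      simp only [hc', hf', if_neg h]
      exact starBound_succ_of_not _ h _ _ _
    -- If the removed vertex is isolated, no bound depends on `z` and the sum over `z` contributes
    -- one factor `Fintype.card X`.
    rcases Nat.eq_zero_or_pos (d 0) with h0 | h0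
    · have hN : ∀ v, ¬ N v 0 := fun v hv => (hd0 v 0 hv).ne' h0
      rw [if_pos h0, pow_succ, mul_assoc]
      gcongr
      rw [sum_congr rfl fun z _ => prod_congr rfl fun v _ => hnot z v (hN v)]
      simp
    · rw [if_neg h0.ne']
      gcongr
      have hne : ({v | N v 0} : Finset β).Nonempty := card_pos.1 (by rwa [hd 0])
      -- Only the `d 0` neighbours of the removed vertex depend on `z`, so Hölder is needed over
      -- these alone.
      have hh := sum_prod_le_prod_sum_pow_card _ hne (fun v z => starBound (fun i => N v i.succ)
        (fun i => d i.succ) (c' z v) (f' z v))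
      rw [hd 0] at hh
      have hsplit : ∀ g : β → ℝ≥0, ∏ v, g v = (∏ v with N v 0, g v) * ∏ v with ¬ N v 0, g v :=
        fun g => (prod_filter_mul_prod_filter_not _ _ _).symm
      rw [hsplit fun v => starBound (N v) d (c v) (f v)]
      calc _ = (∑ z, ∏ v with N v 0, starBound (fun i => N v i.succ)
            (fun i => d i.succ) (c' z v) (f' z v)) *
              ∏ v with ¬ N v 0, starBound (N v) d (c v) (f v) := by
            rw [sum_mul]
            refine sum_congr rfl fun z _ => ?_
            rw [hsplit]
            congr 1
            exact prod_congr rfl fun v hv => hnot z v (by simpa using hv)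
        _ ≤ _ := by
            gcongr
            refine hh.trans (prod_le_prod' fun v hv => ?_)
            have hv' : N v 0 := by simpa using hv
            simp only [hc', hf', if_pos hv']
            exact sum_starBound_pow_le _ hv' d hle (hd0 v) _ _

/-- A weighted inequality for bipartite graphs, given as a relation between two finite types. -/
theorem sum_prod_sum_prod_le {α β X Y : Type*} [Fintype α] [DecidableEq α] [Fintype β] [Fintype X] [Fintype Y]
    (R : α → β → Prop) [∀ u v, Decidable (R u v)] (f : α → β → X → Y → ℝ≥0) :
    ∑ x : α → X, ∏ v, ∑ y, ∏ u with R u v, f u v (x u) y ≤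
      (Fintype.card X : ℝ≥0) ^ #{u | #{v | R u v} = 0} *
        (Fintype.card Y : ℝ≥0) ^ #{v | #{u | R u v} = 0} *
        ∏ v, ∏ u with R u v, bicliqueWeight (f u v) #{w | R u w} #{w | R w v} ^
          (1 / ((#{w | R u w} : ℝ) * #{w | R w v})) := by
  obtain ⟨e, he⟩ : ∃ e : Fin (Fintype.card α) ≃ α, Antitone fun i => #{v | R (e i) v} := by
    let e₀ := (Fintype.equivFin α).symm
    -- Sorting in the order dual lists the vertices by decreasing degree.
    let g : Fin (Fintype.card α) → ℕᵒᵈ := fun i => OrderDual.toDual #{v | R (e₀ i) v}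
    refine ⟨(Tuple.sort g).trans e₀, fun i j hij => ?_⟩
    exact Tuple.monotone_sort g hij
  have main := sum_prod_starWeight_le _ (fun v i => R (e i) v) _ he (fun _ => rfl)
    (fun _ => (Fintype.card Y : ℝ≥0)) (fun v i => f (e i) v)
  have hcard : ∀ (P : α → Prop) [DecidablePred P], #{i | P (e i)} = #{u | P u} := fun P _ => by
    simp only [card_filter]; exact e.sum_comp fun u => if P u then 1 else 0
  have hprod : ∀ (P : α → Prop) [DecidablePred P] (g : α → ℝ≥0),
      ∏ i with P (e i), g (e i) = ∏ u with P u, g u := fun P _ g => by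
    simp only [prod_filter]; exact e.prod_comp fun u => if P u then g u else 1
  have hl : ∀ (x : Fin (Fintype.card α) → X) v, starWeight (fun i => R (e i) v)
      (Fintype.card Y : ℝ≥0) (fun i => f (e i) v) x = ∑ y, ∏ i with R (e i) v, f (e i) v (x i) y := by
    intro x v
    unfold starWeight
    split_ifs with h
    · rw [card_eq_zero] at h
      simp [h]
    · rfl
  have hr : ∀ v, starBound (fun i => R (e i) v) (fun i => #{v | R (e i) v}) (Fintype.card Y : ℝ≥0)
      (fun i => f (e i) v) = (if #{u | R u v} = 0 then (Fintype.card Y : ℝ≥0) else 1) *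
        ∏ u with R u v, bicliqueWeight (f u v) #{w | R u w} #{w | R w v} ^
          (1 / ((#{w | R u w} : ℝ) * #{w | R w v})) := by
    intro v
    unfold starBound
    rw [hcard fun u => R u v]
    split_ifs with h
    · rw [card_eq_zero] at h
      simp [h]
    · rw [one_mul]
      exact hprod (fun u => R u v) fun u => bicliqueWeight (f u v) #{w | R u w} #{w | R w v} ^
          (1 / ((#{w | R u w} : ℝ) * #{w | R w v}))
  simp only [hl, hr] at main
  rw [prod_mul_distrib, ← prod_filter, prod_const, hcard fun u => #{v | R u v} = 0,
    ← mul_assoc] at main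
  refine le_trans (le_of_eq ?_) main
  rw [← (e.arrowCongr (Equiv.refl X)).sum_comp]
  refine sum_congr rfl fun x _ => prod_congr rfl fun v _ => sum_congr rfl fun y _ => ?_
  rw [← hprod fun u => R u v]
  simp [Equiv.arrowCongr]

/-! ### From weights to homomorphism counts -/

section Graph

variable {V W : Type*} [Fintype V] [DecidableEq V] [Fintype W] [DecidableEq W]
  (F : SimpleGraph V) [DecidableRel F.Adj] (G : SimpleGraph W) [DecidableRel G.Adj]

/-- The number of homomorphisms from `K_{p,q}` to `G`. -/
def bicliqueHomCount (p q : ℕ) : ℕ :=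
  ∑ y : Fin p → W, #{x | ∀ j, G.Adj x (y j)} ^ q

omit [DecidableEq W] in
theorem bicliqueHomCount_eq_bicliqueWeight (p q : ℕ) :
    (bicliqueHomCount G p q : ℝ≥0) =
      bicliqueWeight (fun x y => if G.Adj x y then (1 : ℝ≥0) else 0) p q := by
  simp [bicliqueHomCount, bicliqueWeight, prod_boole, sum_boole]

theorem bicliqueHomCount_comm (p q : ℕ) : bicliqueHomCount G p q = bicliqueHomCount G q p := by
  rw [← Nat.cast_inj (R := ℝ≥0), bicliqueHomCount_eq_bicliqueWeight, bicliqueWeight_swap,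
    bicliqueHomCount_eq_bicliqueWeight]
  simp only [G.adj_comm]

/-- Endpoints of edges have positive degree. The restriction matters: for instance `bicliqueSum`
vanishes at `p = 0`, whereas `bicliqueHomCount` is then $|W|^q$. -/
theorem edgeProd_congr {f g : ℕ → ℕ → ℝ} (hf : ∀ p q, f p q = f q p) (hg : ∀ p q, g p q = g q p)
    (h : ∀ p q, 1 ≤ p → 1 ≤ q → f p q = g p q) : edgeProd F f hf = edgeProd F g hg := by
  unfold edgeProd
  refine prod_congr rfl fun e he => ?_
  induction e with
  | _ u v =>
    have hadj : F.Adj u v := by simpa using he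
    simp only [Sym2.lift_mk]
    rw [h _ _ ((F.degree_pos_iff_exists_adj u).2 ⟨v, hadj⟩)
      ((F.degree_pos_iff_exists_adj v).2 ⟨u, hadj.symm⟩)]

variable (p : V → Prop) [DecidablePred p]

theorem edgeProd_eq_prod_prod (hp : ∀ u v, F.Adj u v → (p u ↔ ¬ p v)) (f : ℕ → ℕ → ℝ)
    (hf : ∀ p q, f p q = f q p) :
    edgeProd F f hf = ∏ v : {v // ¬ p v}, ∏ u : {v // p v} with F.Adj u.1 v.1,
      f (F.degree u) (F.degree v) ^ (1 / ((F.degree u : ℝ) * F.degree v)) := by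
  unfold edgeProd
  rw [prod_sigma']
  symm
  refine prod_bij (fun a _ => s((a.2 : V), (a.1 : V))) ?_ ?_ ?_ ?_
  · rintro ⟨v, u⟩ h
    simpa using h
  · rintro ⟨⟨v, hv⟩, ⟨u, hu⟩⟩ h ⟨⟨v', hv'⟩, ⟨u', hu'⟩⟩ h' heq
    simp only [Sym2.eq_iff] at heq
    rcases heq with ⟨rfl, rfl⟩ | ⟨rfl, rfl⟩
    · rfl
    · exact absurd hu hv'
  · intro e he
    induction e with
    | _ u v =>
      have hadj : F.Adj u v := by simpa using he
      by_cases hu : p u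
      · exact ⟨⟨⟨v, (hp u v hadj).1 hu⟩, ⟨u, hu⟩⟩, by simpa using hadj, rfl⟩
      · have hv : p v := by by_contra h; exact hu ((hp u v hadj).2 h)
        exact ⟨⟨⟨u, hu⟩, ⟨v, hv⟩⟩, by simpa using hadj.symm, Sym2.eq_swap⟩
  · rintro ⟨v, u⟩ h
    rfl

omit [DecidableEq W] in
-- Once one colour class is mapped, the vertices of the other choose their images independently.
theorem homCount_eq_sum (hp : ∀ u v, F.Adj u v → (p u ↔ ¬ p v)) :
    (homCount F G : ℝ≥0) = ∑ x : {v // p v} → W, ∏ v : {v // ¬ p v}, ∑ y,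
      ∏ u : {v // p v} with F.Adj u.1 v.1, if G.Adj (x u) y then (1 : ℝ≥0) else 0 := by
  have e : (F →g G) ≃ {z : ({v // p v} → W) × ({v // ¬ p v} → W) //
      ∀ v, ∀ u, F.Adj (u : {v // p v}) (v : {v // ¬ p v}) → G.Adj (z.1 u) (z.2 v)} :=
    { toFun := fun φ => ⟨(fun u => φ u, fun v => φ v), fun v u h => φ.map_adj h⟩
      invFun := fun z => ⟨fun v => if h : p v then z.1.1 ⟨v, h⟩ else z.1.2 ⟨v, h⟩, by
        intro u v h
        by_cases hu : p u
        · have hv := (hp u v h).1 hu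
          simpa [hu, hv] using z.2 ⟨v, hv⟩ ⟨u, hu⟩ h
        · have hv : p v := by by_contra hv; exact hu ((hp u v h).2 hv)
          simpa [hu, hv] using (z.2 ⟨u, hu⟩ ⟨v, hv⟩ h.symm).symm⟩
      left_inv := fun φ => by ext v; by_cases h : p v <;> simp
      right_inv := fun z => by
        ext v
        · simp [v.2]
        · simp [v.2] }
  rw [homCount, Nat.card_congr e, Nat.card_eq_fintype_card, Fintype.card_subtype]
  simp only [prod_univ_sum, Fintype.piFinset_univ]
  rw [← Fintype.sum_prod_type']
  simp only [prod_boole, sum_boole, mem_filter, mem_univ, true_and, true_imp_iff]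

omit [DecidableEq V] in
theorem card_subtype_adj (hp : ∀ u v, F.Adj u v → (p u ↔ ¬ p v)) (u : {v // p v}) :
    #{v : {v // ¬ p v} | F.Adj u v} = F.degree u := by
  rw [← F.card_neighborFinset_eq_degree, ← card_map (Function.Embedding.subtype _)]
  congr 1
  ext v
  simp only [mem_map, mem_filter, mem_univ, true_and, Function.Embedding.subtype_apply,
    Subtype.exists, exists_and_left, exists_prop, exists_eq_right_right,
    SimpleGraph.mem_neighborFinset, and_iff_left_iff_imp]
  exact fun h => (hp _ _ h).1 u.2

omit [DecidableEq V] in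
theorem card_subtype_adj' (hp : ∀ u v, F.Adj u v → (p u ↔ ¬ p v)) (v : {v // ¬ p v}) :
    #{u : {v // p v} | F.Adj u v} = F.degree v := by
  rw [← F.card_neighborFinset_eq_degree, ← card_map (Function.Embedding.subtype _)]
  congr 1
  ext u
  simp only [mem_map, mem_filter, mem_univ, true_and, Function.Embedding.subtype_apply,
    Subtype.exists, exists_and_left, exists_prop, exists_eq_right_right,
    SimpleGraph.mem_neighborFinset, F.adj_comm (v : V), and_iff_left_iff_imp]
  exact fun h => (hp _ _ h).2 v.2

omit [DecidableEq V] in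
theorem isolatedCount_eq_card : isolatedCount F = #{v | F.degree v = 0} := by
  rw [isolatedCount, ← Set.ncard_coe_finset]
  congr 1
  ext v
  simp [F.degree_eq_zero]

theorem isolatedCount_eq_add : isolatedCount F =
    #{v : {v // p v} | F.degree v = 0} + #{v : {v // ¬ p v} | F.degree v = 0} := by
  rw [isolatedCount_eq_card]
  simp only [card_filter]
  rw [← Fintype.sum_subtype_add_sum_subtype p]

theorem homCount_le (hF : F.IsBipartite) : (homCount F G : ℝ) ≤
    (Fintype.card W : ℝ) ^ isolatedCount F * edgeProd F (fun p q => (bicliqueHomCount G p q : ℝ))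
      (fun p q => congrArg Nat.cast (bicliqueHomCount_comm G p q)) := by
  obtain ⟨C⟩ := hF
  have hp : ∀ u v, F.Adj u v → (C u = 0 ↔ ¬ C v = 0) := fun u v h => by
    have := C.valid h
    omega
  have h := sum_prod_sum_prod_le (fun (u : {v // C v = 0}) (v : {v // ¬ C v = 0}) => F.Adj u v)
    (fun _ _ x y => if G.Adj x y then (1 : ℝ≥0) else 0)
  rw [← homCount_eq_sum F G (fun v => C v = 0) hp] at h
  simp only [card_subtype_adj F (fun v => C v = 0) hp, card_subtype_adj' F (fun v => C v = 0) hp,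
    ← bicliqueHomCount_eq_bicliqueWeight] at h
  rw [← pow_add, ← isolatedCount_eq_add F (fun v => C v = 0)] at h
  rw [edgeProd_eq_prod_prod F (fun v => C v = 0) hp]
  have h' := NNReal.coe_le_coe.2 h
  push_cast at h'
  exact h'

end Graph

/-! ### Equality for unions of bicliques -/

section Equality

variable {V W : Type*} [Fintype V] [DecidableEq V] [Fintype W] [DecidableEq W]
  (F : SimpleGraph V) [DecidableRel F.Adj] (G : SimpleGraph W) [DecidableRel G.Adj]

omit [Fintype W] [DecidableEq W] [DecidableRel G.Adj] in
theorem homCount_congr {U U' : Type*} {H : SimpleGraph U} {H' : SimpleGraph U'} (e : H ≃g H') :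
    homCount H G = homCount H' G :=
  Nat.card_congr
    { toFun := fun φ => φ.comp e.symm.toHom
      invFun := fun φ => φ.comp e.toHom
      left_inv := fun φ => by ext; simp
      right_inv := fun φ => by ext; simp }

omit [DecidableEq W] [DecidableRel G.Adj] in
theorem homCount_bot_one : homCount (⊥ : SimpleGraph (Fin 1)) G = Fintype.card W := by
  rw [homCount, ← Nat.card_eq_fintype_card]
  exact Nat.card_congr
    { toFun := fun φ => φ 0
      invFun := fun w => ⟨fun _ => w, fun h => absurd h (by simp)⟩
      left_inv := fun φ => by ext i; simp [Subsingleton.elim i 0]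
      right_inv := fun w => rfl }

omit [DecidableEq W] in
theorem bicliqueHomCount_eq_card (p q : ℕ) : bicliqueHomCount G p q =
    #{z : (Fin p → W) × (Fin q → W) | ∀ i j, G.Adj (z.1 i) (z.2 j)} := by
  rw [bicliqueHomCount, card_filter, Fintype.sum_prod_type]
  refine sum_congr rfl fun y _ => ?_
  rw [← card_filter, ← Fintype.card_fin q, ← Fintype.card_piFinset_const]
  congr 1
  ext x
  simp only [Fintype.mem_piFinset, mem_filter, mem_univ, true_and, G.adj_comm (y _)]
  exact forall_comm

theorem homCount_completeBipartiteGraph (p q : ℕ) :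
    homCount (completeBipartiteGraph (Fin p) (Fin q)) G = bicliqueHomCount G p q := by
  have e : (completeBipartiteGraph (Fin p) (Fin q) →g G) ≃
      {z : (Fin p → W) × (Fin q → W) // ∀ i j, G.Adj (z.1 i) (z.2 j)} :=
    { toFun := fun φ => ⟨(fun i => φ (.inl i), fun j => φ (.inr j)),
        fun i j => φ.map_adj (by simp)⟩
      invFun := fun z => ⟨Sum.elim z.1.1 z.1.2, by
        rintro (i | i) (j | j) h
        · simp at h
        · exact z.2 i j
        · exact (z.2 j i).symm
        · simp at h⟩
      left_inv := fun φ => by ext (i | i) <;> rfl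
      right_inv := fun z => rfl }
  rw [homCount, Nat.card_congr e, Nat.card_eq_fintype_card, Fintype.card_subtype,
    bicliqueHomCount_eq_card]

omit [Fintype V] [DecidableEq V] [Fintype W] [DecidableEq W] [DecidableRel F.Adj] [DecidableRel G.Adj] in
theorem homCount_eq_prod [Fintype F.ConnectedComponent] :
    homCount F G = ∏ c : F.ConnectedComponent, homCount c.toSimpleGraph G := by
  unfold homCount
  rw [← Nat.card_pi]
  exact Nat.card_congr
    { toFun := fun φ c => φ.comp c.toSimpleGraph_hom
      invFun := fun ψ => ⟨fun v => ψ (F.connectedComponentMk v) ⟨v, rfl⟩, by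
        intro u v h
        have hc : F.connectedComponentMk u = F.connectedComponentMk v :=
          SimpleGraph.ConnectedComponent.sound h.reachable
        -- The components of `u` and `v` are equal only propositionally, so `c` is kept general
        -- until it can be substituted.
        have key : ∀ c (hu : F.connectedComponentMk u = c) (hv : F.connectedComponentMk v = c),
            G.Adj (ψ c ⟨u, hu⟩) (ψ c ⟨v, hv⟩) := fun c hu hv =>
          (ψ c).map_adj ((c.toSimpleGraph_adj hu hv).2 h)
        have key' : ∀ c (hu : F.connectedComponentMk u = c) (hv : F.connectedComponentMk v = c),
            G.Adj (ψ c ⟨u, hu⟩) (ψ (F.connectedComponentMk v) ⟨v, rfl⟩) := fun c hu hv => by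
          subst hv; exact key _ hu rfl
        exact key' _ rfl hc.symm⟩
      left_inv := fun φ => by ext; rfl
      right_inv := fun ψ => by
        funext c
        ext ⟨v, hv⟩
        change F.connectedComponentMk v = c at hv
        subst hv
        rfl }

/-- The connected component containing an edge. -/
noncomputable def edgeComponent (e : Sym2 V) : F.ConnectedComponent :=
  F.connectedComponentMk e.out.1

omit [Fintype V] [DecidableEq V] [DecidableRel F.Adj] in
-- Adjacent vertices share a component, so the arbitrary endpoint chosen by `Sym2.out` does not
-- matter.
theorem edgeComponent_mk {u v : V} (h : F.Adj u v) :
    edgeComponent F s(u, v) = F.connectedComponentMk u := by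
  have : s((s(u, v) : Sym2 V).out.1, (s(u, v) : Sym2 V).out.2) = s(u, v) := Quot.out_eq _
  rw [Sym2.eq_iff] at this
  unfold edgeComponent
  rcases this with ⟨h1, _⟩ | ⟨h1, _⟩
  · rw [h1]
  · rw [h1]
    exact SimpleGraph.ConnectedComponent.sound h.symm.reachable

omit [DecidableEq V] in
-- An isolated vertex contributes $|W|$ and no edge. In a $K_{p,q}$ component, the $pq$ equal edge
-- factors with exponent $1/(pq)$ multiply to exactly $\hom(K_{p,q},G)$.
theorem homCount_component_eq {f : ℕ → ℕ → ℝ} (hf : ∀ p q, f p q = f q p)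
    [DecidableEq F.ConnectedComponent]
    (hfG : ∀ p q, 1 ≤ p → 1 ≤ q → f p q = bicliqueHomCount G p q) (c : F.ConnectedComponent)
    (hc : Nonempty (c.toSimpleGraph ≃g (⊥ : SimpleGraph (Fin 1))) ∨ ∃ p q : ℕ, 1 ≤ p ∧ 1 ≤ q ∧
      Nonempty (c.toSimpleGraph ≃g completeBipartiteGraph (Fin p) (Fin q))) :
    (homCount c.toSimpleGraph G : ℝ) =
      (Fintype.card W : ℝ) ^ #{v | F.degree v = 0 ∧ F.connectedComponentMk v = c} *
      ∏ e ∈ F.edgeFinset with edgeComponent F e = c,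
        Sym2.lift ⟨fun u v => f (F.degree u) (F.degree v) ^
          (1 / ((F.degree u : ℝ) * (F.degree v : ℝ))), fun u v => by
            beta_reduce; rw [hf, mul_comm (F.degree u : ℝ)]⟩ e := by
  have hsame : ∀ {u v}, F.Adj u v → F.connectedComponentMk u = c →
      F.connectedComponentMk v = c := fun h hu =>
    (SimpleGraph.ConnectedComponent.sound h.symm.reachable).trans hu
  rcases hc with ⟨⟨φ⟩⟩ | ⟨p, q, hp, hq, ⟨φ⟩⟩
  · rw [homCount_congr G φ, homCount_bot_one]
    have hno : ∀ u v, F.Adj u v → F.connectedComponentMk u ≠ c := fun u v h hu => by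
      have := (c.toSimpleGraph_adj hu (hsame h hu)).2 h
      rw [← φ.map_adj_iff] at this
      simp at this
    have h1 : ({v | F.degree v = 0 ∧ F.connectedComponentMk v = c} : Finset V) =
        {((φ.symm 0 : c) : V)} := by
      ext v
      simp only [mem_filter, mem_univ, true_and, mem_singleton]
      constructor
      · rintro ⟨-, hv⟩
        have : (⟨v, hv⟩ : c) = φ.symm 0 := φ.injective (Subsingleton.elim _ _)
        exact congrArg Subtype.val this
      · rintro rfl
        refine ⟨?_, (φ.symm 0).2⟩
        rw [F.degree_eq_zero]
        exact fun w h => hno _ w h (φ.symm 0).2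
    have h2 : ({e ∈ F.edgeFinset | edgeComponent F e = c} : Finset (Sym2 V)) = ∅ := by
      rw [filter_eq_empty_iff]
      intro e he
      induction e with
      | _ u v =>
        have hadj : F.Adj u v := by simpa using he
        rw [edgeComponent_mk F hadj]
        exact hno u v hadj
    rw [h1, h2]
    simp
  · rw [homCount_congr G φ, homCount_completeBipartiteGraph]
    set a : Fin p → V := fun i => ((φ.symm (.inl i) : c) : V) with ha
    set b : Fin q → V := fun j => ((φ.symm (.inr j) : c) : V) with hb
    have hac : ∀ i, F.connectedComponentMk (a i) = c := fun i => (φ.symm (.inl i)).2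
    have hbc : ∀ j, F.connectedComponentMk (b j) = c := fun j => (φ.symm (.inr j)).2
    have hai : Function.Injective a := fun i j h =>
      Sum.inl_injective (φ.symm.injective (Subtype.val_injective h))
    have hbi : Function.Injective b := fun i j h =>
      Sum.inr_injective (φ.symm.injective (Subtype.val_injective h))
    have hadj : ∀ s t, F.Adj ((φ.symm s : c) : V) ((φ.symm t : c) : V) ↔
        (completeBipartiteGraph (Fin p) (Fin q)).Adj s t := fun s t => by
      rw [← φ.symm.map_adj_iff]
      exact (c.toSimpleGraph_adj (φ.symm s).2 (φ.symm t).2).symm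
    have hab : ∀ i j, F.Adj (a i) (b j) := fun i j => (hadj _ _).2 (by simp)
    have hcover : ∀ v, F.connectedComponentMk v = c → (∃ i, v = a i) ∨ ∃ j, v = b j := by
      intro v hv
      have hv' : v = ((φ.symm (φ ⟨v, hv⟩) : c) : V) := by simp
      rcases h : φ ⟨v, hv⟩ with i | j
      · left; exact ⟨i, by rw [hv', h]⟩
      · right; exact ⟨j, by rw [hv', h]⟩
    have hda : ∀ i, F.degree (a i) = q := by
      intro i
      have : F.neighborFinset (a i) = univ.map ⟨b, hbi⟩ := by
        ext v
        simp only [SimpleGraph.mem_neighborFinset, mem_map, mem_univ, true_and,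
          Function.Embedding.coeFn_mk]
        constructor
        · intro h
          rcases hcover v (hsame h (hac i)) with ⟨i', rfl⟩ | ⟨j, rfl⟩
          · have := (hadj _ _).1 h
            simp at this
          · exact ⟨j, rfl⟩
        · rintro ⟨j, rfl⟩
          exact hab i j
      rw [← F.card_neighborFinset_eq_degree, this, card_map, card_univ, Fintype.card_fin]
    have hdb : ∀ j, F.degree (b j) = p := by
      intro j
      have : F.neighborFinset (b j) = univ.map ⟨a, hai⟩ := by
        ext v
        simp only [SimpleGraph.mem_neighborFinset, mem_map, mem_univ, true_and,
          Function.Embedding.coeFn_mk]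
        constructor
        · intro h
          rcases hcover v (hsame h (hbc j)) with ⟨i, rfl⟩ | ⟨j', rfl⟩
          · exact ⟨i, rfl⟩
          · have := (hadj _ _).1 h
            simp at this
        · rintro ⟨i, rfl⟩
          exact (hab i j).symm
      rw [← F.card_neighborFinset_eq_degree, this, card_map, card_univ, Fintype.card_fin]
    have h1 : ({v | F.degree v = 0 ∧ F.connectedComponentMk v = c} : Finset V) = ∅ := by
      rw [filter_eq_empty_iff]
      rintro v - ⟨h0, hv⟩
      rcases hcover v hv with ⟨i, rfl⟩ | ⟨j, rfl⟩
      · rw [hda] at h0; omega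
      · rw [hdb] at h0; omega
    have h2 : ∏ e ∈ F.edgeFinset with edgeComponent F e = c,
        Sym2.lift ⟨fun u v => f (F.degree u) (F.degree v) ^
          (1 / ((F.degree u : ℝ) * (F.degree v : ℝ))), fun u v => by
            beta_reduce; rw [hf, mul_comm (F.degree u : ℝ)]⟩ e =
        ∏ _x : Fin p × Fin q, f p q ^ (1 / ((p : ℝ) * q)) := by
      symm
      refine prod_bij (fun x _ => s(a x.1, b x.2)) ?_ ?_ ?_ ?_
      · rintro ⟨i, j⟩ -
        simp only [mem_filter, SimpleGraph.mem_edgeFinset, SimpleGraph.mem_edgeSet]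
        exact ⟨hab i j, (edgeComponent_mk F (hab i j)).trans (hac i)⟩
      · rintro ⟨i, j⟩ - ⟨i', j'⟩ - h
        simp only [Sym2.eq_iff] at h
        rcases h with ⟨h, h'⟩ | ⟨h, -⟩
        · rw [hai h, hbi h']
        · have := hab i j'
          rw [h] at this
          exact absurd this (F.loopless.irrefl _)
      · intro e he
        induction e with
        | _ u v =>
          simp only [mem_filter, SimpleGraph.mem_edgeFinset, SimpleGraph.mem_edgeSet] at he
          obtain ⟨h, hec⟩ := he
          rw [edgeComponent_mk F h] at hec
          rcases hcover u hec with ⟨i, rfl⟩ | ⟨j, rfl⟩ <;>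
            rcases hcover v (hsame h hec) with ⟨i', rfl⟩ | ⟨j', rfl⟩
          · have := (hadj _ _).1 h
            simp at this
          · exact ⟨(i, j'), mem_univ _, rfl⟩
          · exact ⟨(i', j), mem_univ _, Sym2.eq_swap⟩
          · have := (hadj _ _).1 h
            simp at this
      · rintro ⟨i, j⟩ -
        simp only [Sym2.lift_mk, hda, hdb]
        rw [hf, mul_comm (p : ℝ)]
    have hpq : ((p * q : ℕ) : ℝ) ≠ 0 := by
      have : 0 < p * q := Nat.mul_pos hp hq
      exact_mod_cast this.ne'
    rw [h1, h2, prod_const, card_univ, Fintype.card_prod, Fintype.card_fin, Fintype.card_fin,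
      card_empty, pow_zero, one_mul, hfG p q hp hq, ← Real.rpow_natCast, ← Real.rpow_mul (by positivity)]
    rw [← Nat.cast_mul, one_div_mul_cancel hpq, Real.rpow_one]

theorem homCount_eq_of_isUnionOfBicliques {f : ℕ → ℕ → ℝ} (hf : ∀ p q, f p q = f q p)
    (hfG : ∀ p q, 1 ≤ p → 1 ≤ q → f p q = bicliqueHomCount G p q) (hF : IsUnionOfBicliques F) :
    (homCount F G : ℝ) = (Fintype.card W : ℝ) ^ isolatedCount F * edgeProd F f hf := by
  classical
  have : Fintype F.ConnectedComponent := Fintype.ofFinite _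
  rw [homCount_eq_prod, Nat.cast_prod,
    prod_congr rfl fun c _ => homCount_component_eq F G hf hfG c (hF c), prod_mul_distrib]
  congr 1
  · rw [prod_pow_eq_pow_sum, isolatedCount_eq_card,
      card_eq_sum_card_fiberwise (f := F.connectedComponentMk) (t := univ) (by simp)]
    simp only [filter_filter]
  · exact prod_fiberwise _ _ _

end Equality

/-! ### Evaluating the number of homomorphisms from a biclique -/

/-- The head `w` of a tuple with image `A` lies in `A`, and its tail has image `A` or `A.erase w`.
Summing over the `#A` heads gives the Stirling recurrence multiplied by `(#A)!`. -/
theorem card_filter_image_eq {W : Type*} [Fintype W] [DecidableEq W] (n : ℕ) (A : Finset W) :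
    #{x : Fin n → W | univ.image x = A} = (#A).factorial * n.stirlingSecond #A := by
  induction n generalizing A with
  | zero =>
    rcases A.eq_empty_or_nonempty with rfl | hA
    · simp
    · obtain ⟨k, hk⟩ := Nat.exists_eq_succ_of_ne_zero hA.card_ne_zero
      simp [hk, hA.ne_empty.symm]
  | succ n ih =>
    have himg : ∀ (w : W) (x : Fin n → W),
        univ.image (Fin.cons w x : Fin (n + 1) → W) = insert w (univ.image x) := by
      intro w x
      ext v
      simp [Fin.exists_fin_succ, eq_comm]
    have hw : ∀ w, #{x : Fin n → W | insert w (univ.image x) = A} =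
        if w ∈ A then (#A).factorial * n.stirlingSecond #A +
          (#A - 1).factorial * n.stirlingSecond (#A - 1) else 0 := by
      intro w
      split_ifs with h
      · rw [← card_erase_of_mem h, ← ih, ← ih, ← card_union_of_disjoint]
        · congr 1
          ext x
          simp only [mem_filter, mem_univ, true_and, mem_union]
          constructor
          · intro hx
            by_cases hwx : w ∈ univ.image x
            · left; rwa [insert_eq_of_mem hwx] at hx
            · right; rw [← hx, erase_insert hwx]
          · rintro (hx | hx)
            · rw [hx, insert_eq_of_mem h]
            · rw [hx, insert_erase h]
        · rw [disjoint_filter]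
          intro x _ h1 h2
          rw [h1] at h2
          exact absurd (h2 ▸ h) (notMem_erase _ _)
      · rw [card_eq_zero, filter_eq_empty_iff]
        rintro x - rfl
        exact h (mem_insert_self _ _)
    rw [card_filter, ← (Fin.consEquiv fun _ => W).sum_comp, Fintype.sum_prod_type]
    simp only [Fin.consEquiv, Equiv.coe_fn_mk, himg, ← card_filter, hw]
    rw [← sum_filter, filter_mem_eq_inter, univ_inter, sum_const, smul_eq_mul]
    rcases h : #A with _ | k
    · simp
    · rw [Nat.stirlingSecond_succ_succ, Nat.factorial_succ, Nat.add_sub_cancel]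
      ring

section Count

variable {W : Type*} [Fintype W] [DecidableEq W] (G : SimpleGraph W) [DecidableRel G.Adj]

/-- Adjacency of two tuples depends only on their images, so pairs of tuples are grouped by image
sets. -/
theorem bicliqueHomCount_eq_sum (p q : ℕ) : bicliqueHomCount G p q =
    ∑ P : Finset W × Finset W, if ∀ a ∈ P.1, ∀ b ∈ P.2, G.Adj a b then
      (#P.1).factorial * (#P.2).factorial * p.stirlingSecond #P.1 * q.stirlingSecond #P.2
      else 0 := by
  rw [bicliqueHomCount_eq_card, card_eq_sum_card_fiberwise
    (f := fun z => (univ.image z.1, univ.image z.2)) (t := univ) (by simp)]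
  refine sum_congr rfl fun P _ => ?_
  rw [filter_filter]
  split_ifs with h
  · calc _ = #(({x : Fin p → W | univ.image x = P.1} : Finset _) ×ˢ
          ({x : Fin q → W | univ.image x = P.2} : Finset _)) := by
          congr 1
          ext z
          simp only [mem_filter, mem_univ, true_and, mem_product, Prod.ext_iff,
            and_iff_right_iff_imp]
          rintro ⟨h1, h2⟩ i j
          exact h _ (h1 ▸ mem_image_of_mem _ (mem_univ _)) _ (h2 ▸ mem_image_of_mem _ (mem_univ _))
      _ = _ := by
          rw [card_product, card_filter_image_eq, card_filter_image_eq]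
          ring
  · rw [card_eq_zero, filter_eq_empty_iff]
    rintro z - ⟨hz, rfl⟩
    refine h ?_
    simpa using hz

theorem sum_bicliqueCount_mul (L R : Finset W) (p q : ℕ) (w : ℕ → ℕ → ℕ)
    (hw : ∀ k l, w k l ≠ 0 → k ∈ Icc 1 p ∧ l ∈ Icc 1 q) :
    ∑ k ∈ Icc 1 p, ∑ l ∈ Icc 1 q, w k l * bicliqueCount G L R k l =
      ∑ P ∈ L.powerset ×ˢ R.powerset, if ∀ a ∈ P.1, ∀ b ∈ P.2, G.Adj a b then
        w #P.1 #P.2 else 0 := by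
  have h1 : ∀ k l, w k l * bicliqueCount G L R k l = ∑ P ∈ L.powerset ×ˢ R.powerset,
      if ∀ a ∈ P.1, ∀ b ∈ P.2, G.Adj a b then
        (if #P.2 = l then (if #P.1 = k then w k l else 0) else 0) else 0 := by
    intro k l
    rw [bicliqueCount, mul_comm, ← smul_eq_mul, ← sum_const]
    simp only [← ite_and]
    rw [← sum_filter]
    refine sum_congr ?_ fun _ _ => rfl
    ext P
    simp only [mem_filter, mem_product, mem_powersetCard, mem_powerset]
    tauto
  simp only [h1]
  rw [sum_congr rfl fun k _ => sum_comm, sum_comm]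
  refine sum_congr rfl fun P _ => ?_
  split_ifs with h
  · simp only [sum_ite_eq]
    by_cases h0 : w #P.1 #P.2 = 0
    · rw [h0]
      refine sum_eq_zero fun k _ => ?_
      split_ifs with h2 h3
      · rw [← h3, h0]
      all_goals rfl
    · obtain ⟨hk, hl⟩ := hw _ _ h0
      simp only [hl, if_true, sum_ite_eq, hk]
  · simp

/-- A completely joined pair of nonempty sets lies in `L × R` or in `R × L`, never both; these cases
account for $N_{k,\ell}$ and $N_{\ell,k}$. -/
theorem bicliqueHomCount_eq_bicliqueSum (L R : Finset W)
    (h : G.IsBipartiteWith (L : Set W) (R : Set W)) (p q : ℕ) (hp : 1 ≤ p) (hq : 1 ≤ q) :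
    bicliqueHomCount G p q = bicliqueSum G L R p q := by
  have hS : ∀ n k, 1 ≤ n → n.stirlingSecond k ≠ 0 → k ∈ Icc 1 n := by
    intro n k hn hk
    rw [mem_Icc]
    constructor
    · rcases k with _ | k
      · obtain ⟨m, rfl⟩ := Nat.exists_eq_add_of_le' hn
        exact absurd (Nat.stirlingSecond_succ_zero m) hk
      · omega
    · by_contra hlt
      exact hk (Nat.stirlingSecond_eq_zero_of_lt (by omega))
  have hw : ∀ k l, k.factorial * l.factorial * p.stirlingSecond k * q.stirlingSecond l ≠ 0 →
      k ∈ Icc 1 p ∧ l ∈ Icc 1 q := fun k l hkl =>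
    ⟨hS _ _ hp (by rintro h; simp [h] at hkl), hS _ _ hq (by rintro h; simp [h] at hkl)⟩
  set H : Finset W × Finset W → ℕ := fun P => if ∀ a ∈ P.1, ∀ b ∈ P.2, G.Adj a b then
      (#P.1).factorial * (#P.2).factorial * p.stirlingSecond #P.1 * q.stirlingSecond #P.2
      else 0 with hH
  have hsum : bicliqueSum G L R p q =
      ∑ P ∈ L.powerset ×ˢ R.powerset, H P + ∑ P ∈ R.powerset ×ˢ L.powerset, H P := by
    unfold bicliqueSum
    simp only [mul_add, sum_add_distrib]
    rw [sum_bicliqueCount_mul G L R p q (fun k l => k.factorial * l.factorial *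
      p.stirlingSecond k * q.stirlingSecond l) hw, sum_comm,
      sum_bicliqueCount_mul G L R q p (fun l k => k.factorial * l.factorial *
        p.stirlingSecond k * q.stirlingSecond l) (fun l k hlk => (hw k l hlk).symm)]
    congr 1
    refine sum_nbij' Prod.swap Prod.swap ?_ ?_ (by simp) (by simp) ?_
    · simp only [mem_product, mem_powerset]; exact fun P hP => hP.symm
    · simp only [mem_product, mem_powerset]; exact fun P hP => hP.symm
    · intro P _
      simp only [hH, Prod.fst_swap, Prod.snd_swap]
      congr 1
      exact propext ⟨fun hP b hb a ha => (hP a ha b hb).symm,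
        fun hP a ha b hb => (hP b hb a ha).symm⟩
  have hne : ∀ P, H P ≠ 0 → P.1.Nonempty ∧ P.2.Nonempty ∧ ∀ a ∈ P.1, ∀ b ∈ P.2, G.Adj a b := by
    intro P hP
    simp only [hH, ne_eq, ite_eq_right_iff, not_forall, exists_prop] at hP
    obtain ⟨hadj, hP⟩ := hP
    obtain ⟨h1, h2⟩ := hw _ _ hP
    rw [mem_Icc] at h1 h2
    exact ⟨card_pos.1 h1.1, card_pos.1 h2.1, hadj⟩
  have hdisj : ∀ v, v ∈ L → v ∉ R := fun v hv hv' =>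
    Set.disjoint_left.1 h.disjoint (mem_coe.2 hv) (mem_coe.2 hv')
  rw [hsum, ← sum_union_inter, bicliqueHomCount_eq_sum]
  -- The families overlap only in pairs of empty sets, where the Stirling numbers vanish because `p`
  -- and `q` are positive.
  have h0 : ∑ P ∈ L.powerset ×ˢ R.powerset ∩ R.powerset ×ˢ L.powerset, H P = 0 := by
    refine sum_eq_zero fun P hP => ?_
    by_contra hne0
    obtain ⟨⟨a, ha⟩, -, -⟩ := hne P hne0
    simp only [mem_inter, mem_product, mem_powerset] at hP
    exact hdisj a (hP.1.1 ha) (hP.2.1 ha)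
  rw [h0, add_zero]
  symm
  refine sum_subset (subset_univ _) fun P _ hP => ?_
  by_contra hne0
  obtain ⟨⟨a, ha⟩, ⟨b, hb⟩, hadj⟩ := hne P hne0
  refine hP ?_
  simp only [mem_union, mem_product, mem_powerset]
  have hmem : ∀ {u v}, G.Adj u v → (u ∈ L ∧ v ∈ R) ∨ (u ∈ R ∧ v ∈ L) := fun huv => by
    simpa using h.mem_of_adj huv
  rcases hmem (hadj a ha b hb) with ⟨haL, hbR⟩ | ⟨haR, hbL⟩
  · left
    constructor
    · intro a' ha'
      rcases hmem (hadj a' ha' b hb) with h' | h'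
      · exact h'.1
      · exact absurd hbR (hdisj b h'.2)
    · intro b' hb'
      rcases hmem (hadj a ha b' hb') with h' | h'
      · exact h'.2
      · exact absurd h'.1 (hdisj a haL)
  · right
    constructor
    · intro a' ha'
      rcases hmem (hadj a' ha' b hb) with h' | h'
      · exact absurd h'.2 (hdisj b hbL)
      · exact h'.1
    · intro b' hb'
      rcases hmem (hadj a ha b' hb') with h' | h'
      · exact absurd haR (hdisj a h'.1)
      · exact h'.2

omit [Fintype W] [DecidableEq W] [DecidableRel G.Adj] in
theorem eq_or_eq_of_cycleGraph_four_free (h : (SimpleGraph.cycleGraph 4).Free G) {a a' b b' : W}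
    (h1 : G.Adj a b) (h2 : G.Adj a b') (h3 : G.Adj a' b) (h4 : G.Adj a' b') :
    a = a' ∨ b = b' := by
  by_contra hne
  rw [not_or] at hne
  obtain ⟨ha, hb⟩ := hne
  refine h ⟨⟨⟨![a, b, a', b'], ?_⟩, ?_⟩⟩
  · intro i j hij
    rw [SimpleGraph.cycleGraph_adj] at hij
    fin_cases i <;> fin_cases j <;> simp_all [G.adj_comm] <;> exact absurd hij (by decide)
  · intro i j hij
    fin_cases i <;> fin_cases j <;>
      simp_all [h1.ne, h2.ne, h3.ne, h4.ne, h1.ne', h2.ne', h3.ne', h4.ne', eq_comm]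

/-- Two nonconstant, completely joined tuples would contain a 4-cycle. So one tuple is constant and
the other lies in a neighbourhood, giving the two power sums; pairs with both constant are oriented
edges, counted twice, whence $-2|E(G)|$. -/
theorem bicliqueHomCount_eq_degreeSum (h : (SimpleGraph.cycleGraph 4).Free G) (p q : ℕ)
    (hp : 1 ≤ p) (hq : 1 ≤ q) : (bicliqueHomCount G p q : ℝ) = degreeSum G p q := by
  obtain ⟨p, rfl⟩ := Nat.exists_eq_add_of_le' hp
  obtain ⟨q, rfl⟩ := Nat.exists_eq_add_of_le' hq
  set T : Finset ((Fin (p + 1) → W) × (Fin (q + 1) → W)) :=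
    {z | ∀ i j, G.Adj (z.1 i) (z.2 j)} with hT
  set T₁ := T.filter fun z => ∀ i, z.1 i = z.1 0 with hT₁
  set T₂ := T.filter fun z => ∀ j, z.2 j = z.2 0 with hT₂
  have hunion : T₁ ∪ T₂ = T := by
    rw [hT₁, hT₂, ← filter_or, filter_eq_self]
    intro z hz
    have hz' : ∀ i j, G.Adj (z.1 i) (z.2 j) := by simpa [hT] using hz
    by_contra hne
    rw [not_or, not_forall, not_forall] at hne
    obtain ⟨⟨i, hi⟩, ⟨j, hj⟩⟩ := hne
    rcases eq_or_eq_of_cycleGraph_four_free G h (hz' i j) (hz' i 0) (hz' 0 j) (hz' 0 0) with h' | h'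
    · exact hi h'
    · exact hj h'
  have c₁ : #T₁ = ∑ w, G.degree w ^ (q + 1) := by
    have : #(univ.sigma fun w => Fintype.piFinset fun _ : Fin (q + 1) => G.neighborFinset w) =
        #T₁ := by
      refine card_bij (fun a _ => (fun _ => a.1, a.2)) ?_ ?_ ?_
      · rintro ⟨w, x⟩ hx
        simpa [hT, hT₁] using hx
      · rintro ⟨w, x⟩ - ⟨w', x'⟩ - heq
        simp only [Prod.mk.injEq] at heq
        obtain ⟨h1, rfl⟩ := heq
        obtain rfl := congrFun h1 0
        rfl
      · rintro ⟨y, x⟩ hz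
        simp only [hT, hT₁, mem_filter, mem_univ, true_and] at hz
        refine ⟨⟨y 0, x⟩, by simpa using hz.1 0, ?_⟩
        simp only [Prod.mk.injEq, and_true]
        exact funext fun i => (hz.2 i).symm
    rw [← this, card_sigma]
    simp
  have c₂ : #T₂ = ∑ w, G.degree w ^ (p + 1) := by
    have : #(univ.sigma fun w => Fintype.piFinset fun _ : Fin (p + 1) => G.neighborFinset w) =
        #T₂ := by
      refine card_bij (fun a _ => (a.2, fun _ => a.1)) ?_ ?_ ?_
      · rintro ⟨w, x⟩ hx
        simpa [hT, hT₂, G.adj_comm] using hx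
      · rintro ⟨w, x⟩ - ⟨w', x'⟩ - heq
        simp only [Prod.mk.injEq] at heq
        obtain ⟨rfl, h1⟩ := heq
        obtain rfl := congrFun h1 0
        rfl
      · rintro ⟨y, x⟩ hz
        simp only [hT, hT₂, mem_filter, mem_univ, true_and] at hz
        refine ⟨⟨x 0, y⟩, by simpa using fun i => (hz.1 i 0).symm, ?_⟩
        simp only [Prod.mk.injEq, true_and]
        exact funext fun i => (hz.2 i).symm
    rw [← this, card_sigma]
    simp
  have c₁₂ : #(T₁ ∩ T₂) = 2 * #G.edgeFinset := by
    rw [← G.sum_degrees_eq_twice_card_edges]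
    have : #(univ.sigma fun w => G.neighborFinset w) = #(T₁ ∩ T₂) := by
      refine card_bij (fun a _ => (fun _ => a.1, fun _ => a.2)) ?_ ?_ ?_
      · rintro ⟨w, v⟩ hx
        simpa [hT, hT₁, hT₂] using hx
      · rintro ⟨w, x⟩ - ⟨w', x'⟩ - heq
        simp only [Prod.mk.injEq] at heq
        obtain ⟨h1, h2⟩ := heq
        obtain rfl := congrFun h1 0
        obtain rfl := congrFun h2 0
        rfl
      · rintro ⟨y, x⟩ hz
        simp only [hT, hT₁, hT₂, mem_inter, mem_filter, mem_univ, true_and] at hz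
        refine ⟨⟨y 0, x 0⟩, by simpa using hz.1.1 0 0, ?_⟩
        simp only [Prod.mk.injEq]
        exact ⟨funext fun i => (hz.1.2 i).symm, funext fun i => (hz.2.2 i).symm⟩
    rw [← this, card_sigma]
    simp
  have hcard := card_union_add_card_inter T₁ T₂
  rw [hunion, c₁, c₂, c₁₂] at hcard
  have hc : (#T : ℝ) + 2 * #G.edgeFinset =
      ∑ w, (G.degree w : ℝ) ^ (q + 1) + ∑ w, (G.degree w : ℝ) ^ (p + 1) := by exact_mod_cast hcard
  rw [bicliqueHomCount_eq_card, degreeSum, sum_add_distrib]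
  linarith

end Count

theorem IsUnionOfStars.isUnionOfBicliques {V : Type*} {F : SimpleGraph V}
    (h : IsUnionOfStars F) : IsUnionOfBicliques F := fun c =>
  (h c).imp_right fun ⟨m, hm, e⟩ => ⟨1, m, le_rfl, hm, e⟩

end BipartiteHom

/-! ### The main theorem -/

open BipartiteHom in
theorem mainTheorem5 {V W : Type*}
    [Fintype V] [DecidableEq V] [Fintype W] [DecidableEq W]
    (F : SimpleGraph V) [DecidableRel F.Adj] (hF : F.IsBipartite)
    (G : SimpleGraph W) [DecidableRel G.Adj] (hG : G.IsBipartite)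
    (s : ℕ) (hs : BipartiteHom.isolatedCount F = s) :
    (Nonempty W → ∀ L R : Finset W, G.IsBipartiteWith (L : Set W) (R : Set W) →
      ((BipartiteHom.homCount F G : ℝ) / (Fintype.card W : ℝ) ^ s ≤
        BipartiteHom.edgeProd F (fun p q => (BipartiteHom.bicliqueSum G L R p q : ℝ))
          (fun p q => congrArg Nat.cast (BipartiteHom.bicliqueSum_comm G L R p q))) ∧
      (BipartiteHom.IsUnionOfBicliques F →
        (BipartiteHom.homCount F G : ℝ) / (Fintype.card W : ℝ) ^ s =
          BipartiteHom.edgeProd F (fun p q => (BipartiteHom.bicliqueSum G L R p q : ℝ))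
            (fun p q => congrArg Nat.cast (BipartiteHom.bicliqueSum_comm G L R p q)))) ∧
    ((SimpleGraph.cycleGraph 4).Free G →
      ((BipartiteHom.homCount F G : ℝ) ≤
        (Fintype.card W : ℝ) ^ s *
          BipartiteHom.edgeProd F (BipartiteHom.degreeSum G) (BipartiteHom.degreeSum_comm G)) ∧
      (BipartiteHom.IsUnionOfStars F →
        (BipartiteHom.homCount F G : ℝ) =
          (Fintype.card W : ℝ) ^ s *
            BipartiteHom.edgeProd F (BipartiteHom.degreeSum G)
              (BipartiteHom.degreeSum_comm G))) := by
  subst hs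
  have hle := homCount_le F G hF
  refine ⟨fun _ L R hLR => ?_, fun hC => ⟨?_, fun hS => ?_⟩⟩
  · have hK : ∀ p q, 1 ≤ p → 1 ≤ q → (bicliqueSum G L R p q : ℝ) = bicliqueHomCount G p q :=
      fun p q hp hq => by rw [bicliqueHomCount_eq_bicliqueSum G L R hLR p q hp hq]
    have hW : (0 : ℝ) < (Fintype.card W : ℝ) ^ isolatedCount F :=
      pow_pos (by exact_mod_cast Fintype.card_pos) _
    refine ⟨?_, fun hU => ?_⟩
    · rw [div_le_iff₀' hW, edgeProd_congr F _ _ hK]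
      exact hle
    · rw [div_eq_iff hW.ne', mul_comm]
      exact homCount_eq_of_isUnionOfBicliques F G _ hK hU
  · rw [edgeProd_congr F (degreeSum_comm G) _
      fun p q hp hq => (bicliqueHomCount_eq_degreeSum G hC p q hp hq).symm]
    exact hle
  · exact homCount_eq_of_isUnionOfBicliques F G _
      (fun p q hp hq => (bicliqueHomCount_eq_degreeSum G hC p q hp hq).symm)
      hS.isUnionOfBicliques
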